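/- **Conventions.** Let $H^3=\{(z,t): z\in\mathbb C,\ t>0\}$ be hyperbolic $3$-space, with its distance $d$ of curvature $-1$, given by $\cosh d\big((z,t),(w,s)\big)=1+\frac{|z-w|^2+(t-s)^2}{2ts}$. Let $S=\mathbb C\cup\{\infty\}$ be the Riemann sphere, viewed as the ideal boundary of $H^3$; every isometry of $H^3$ extends continuously to a homeomorphism of $S$, so that groups of isometries of $H^3$ act on $S$. A *nice lattice* is a group $\Gamma$ of isometries of $H^3$ such that $H^3/\Gamma$ is a compact Hausdorff space and $H^3\to H^3/\Gamma$ is a covering map (that is, $H^3/\Gamma$ is a compact hyperbolic $3$-manifold with deck group $\Gamma$). A homeomorphism $h:S\to S$ is *equivariant* if there are nice lattices $\Gamma_1,\Gamma_2$ with $h\Gamma_1h^{-1}=\Gamma_2$ as groups acting on $S$. A *disk* is a round disk in $\mathbb C=\mathbb R^2$, open or closed, of positive radius. **Theorem (Disk).** Let $h:S\to S$ be an equivariant homeomorphism with $h(\infty)=\infty$. There is a constant $K$, depending only on $h$, such that for every disk $\Delta\subset\mathbb C$ there are disks $D_1,D_2\subset\mathbb C$ with $$D_1\subset h(\Delta)\subset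 D_2\qquad\text{and}\qquad \frac{\operatorname{diam}(D_2)}{\operatorname{diam}(D_1)}<K .$$ -/

import Mathlib

open Filter Topology

noncomputable section

/-- Points `(z, t)` of the upper half-space `ℂ × (0, ∞)`. -/
@[ext]
structure HypSpace where
  z : ℂ
  t : ℝ
  t_pos : 0 < t

namespace HypSpace

/-- The point as an element of the Euclidean space `ℂ × ℝ`. -/
def toEucl (p : HypSpace) : WithLp 2 (ℂ × ℝ) := WithLp.toLp 2 (p.z, p.t)

/-- The Euclidean mirror image in the plane `ℂ × {0}`. -/
def mirror (p : HypSpace) : WithLp 2 (ℂ × ℝ) := WithLp.toLp 2 (p.z, -p.t)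

/-- The hyperbolic distance of curvature `-1`:
`2 arsinh (|p - q| / (2 √(t s)))` for `p = (z, t)`, `q = (w, s)`, with `|p - q|` Euclidean. -/
instance : Dist HypSpace :=
  ⟨fun p q => 2 * Real.arsinh (dist p.toEucl q.toEucl / (2 * √(p.t * q.t)))⟩

theorem dist_def (p q : HypSpace) :
    dist p q = 2 * Real.arsinh (dist p.toEucl q.toEucl / (2 * √(p.t * q.t))) := rfl

theorem eucl_dist_sq (p q : HypSpace) :
    dist p.toEucl q.toEucl ^ 2 = dist p.z q.z ^ 2 + (p.t - q.t) ^ 2 := by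
  rw [WithLp.prod_dist_eq_of_L2, Real.sq_sqrt (by positivity), Real.dist_eq, sq_abs]
  rfl

theorem mirror_dist_sq (p q : HypSpace) :
    dist p.toEucl q.mirror ^ 2 = dist p.z q.z ^ 2 + (p.t + q.t) ^ 2 := by
  rw [WithLp.prod_dist_eq_of_L2, Real.sq_sqrt (by positivity), Real.dist_eq, sq_abs]
  simp [toEucl, mirror]

theorem sinh_half_dist (p q : HypSpace) :
    Real.sinh (dist p q / 2) = dist p.toEucl q.toEucl / (2 * √(p.t * q.t)) := by
  rw [dist_def, mul_div_cancel_left₀ _ (two_ne_zero' ℝ), Real.sinh_arsinh]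

/-- The usual formula `cosh d = 1 + (|z - w|² + (t - s)²) / (2 t s)`. -/
theorem cosh_dist (p q : HypSpace) :
    Real.cosh (dist p q) =
      1 + (dist p.z q.z ^ 2 + (p.t - q.t) ^ 2) / (2 * p.t * q.t) := by
  have hp := p.t_pos
  have hq := q.t_pos
  have h : dist p q = 2 * (dist p q / 2) := by ring
  rw [h, Real.cosh_two_mul, Real.cosh_sq, sinh_half_dist, div_pow, mul_pow,
    Real.sq_sqrt (by positivity), eucl_dist_sq]
  field_simp
  ring

theorem cosh_half_dist (p q : HypSpace) :
    Real.cosh (dist p q / 2) = dist p.toEucl q.mirror / (2 * √(p.t * q.t)) := by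
  have hp := p.t_pos
  have hq := q.t_pos
  rw [← sq_eq_sq₀ (Real.cosh_pos _).le (by positivity), Real.cosh_sq', sinh_half_dist, div_pow,
    div_pow, mul_pow, Real.sq_sqrt (by positivity), eucl_dist_sq, mirror_dist_sq]
  field_simp
  ring

theorem dist_mirror_comm (p q : HypSpace) : dist p.toEucl q.mirror = dist q.toEucl p.mirror := by
  rw [← sq_eq_sq₀ dist_nonneg dist_nonneg, mirror_dist_sq, mirror_dist_sq, dist_comm p.z]
  ring

theorem dist_mirror_self (p : HypSpace) : dist p.toEucl p.mirror = 2 * p.t := by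
  have hp := p.t_pos
  rw [← sq_eq_sq₀ dist_nonneg (by positivity), mirror_dist_sq, dist_self]
  ring

protected theorem dist_triangle (a b c : HypSpace) : dist a c ≤ dist a b + dist b c := by
  have ha := a.t_pos
  have hb := b.t_pos
  have hc := c.t_pos
  have hpt := EuclideanGeometry.mul_dist_le_mul_dist_add_mul_dist
    a.toEucl b.toEucl c.toEucl b.mirror
  rw [dist_mirror_self] at hpt
  have key : Real.sinh (dist a c / 2) ≤ Real.sinh (dist a b / 2 + dist b c / 2) := by
    rw [Real.sinh_add, sinh_half_dist, sinh_half_dist, sinh_half_dist, cosh_half_dist,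
      cosh_half_dist, dist_mirror_comm b c, Real.sqrt_mul ha.le, Real.sqrt_mul ha.le,
      Real.sqrt_mul hb.le]
    have h1 : dist a.toEucl b.toEucl / (2 * (√a.t * √b.t)) *
          (dist c.toEucl b.mirror / (2 * (√b.t * √c.t))) +
        dist a.toEucl b.mirror / (2 * (√a.t * √b.t)) *
          (dist b.toEucl c.toEucl / (2 * (√b.t * √c.t))) =
        (dist a.toEucl b.toEucl * dist c.toEucl b.mirror +
          dist b.toEucl c.toEucl * dist a.toEucl b.mirror) /
          (2 * b.t * (2 * (√a.t * √c.t))) := by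
      rw [div_mul_div_comm, div_mul_div_comm, ← add_div]
      have : 2 * (√a.t * √b.t) * (2 * (√b.t * √c.t)) = 2 * b.t * (2 * (√a.t * √c.t)) := by
        linear_combination 4 * √a.t * √c.t * Real.mul_self_sqrt hb.le
      rw [this]
      ring
    rw [h1, le_div_iff₀ (by positivity)]
    have h2 : dist a.toEucl c.toEucl / (2 * (√a.t * √c.t)) * (2 * b.t * (2 * (√a.t * √c.t))) =
        dist a.toEucl c.toEucl * (2 * b.t) := by
      field_simp
    rw [h2]
    exact hpt
  have := Real.sinh_le_sinh.1 key
  linarith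

/-- Hyperbolic 3-space as a metric space. -/
instance : MetricSpace HypSpace where
  dist_self p := by simp [dist_def]
  dist_comm p q := by rw [dist_def, dist_def, dist_comm p.toEucl, mul_comm p.t]
  dist_triangle := HypSpace.dist_triangle
  eq_of_dist_eq_zero {p q} h := by
    have hp := p.t_pos
    have hq := q.t_pos
    have h0 : dist p.toEucl q.toEucl ^ 2 = 0 := by
      have h1 := sinh_half_dist p q
      rw [h, zero_div, Real.sinh_zero, eq_comm, div_eq_zero_iff] at h1
      rcases h1 with h1 | h1
      · rw [h1]; norm_num
      · exact absurd h1 (by positivity)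
    rw [eucl_dist_sq] at h0
    have hz : dist p.z q.z = 0 := by nlinarith [sq_nonneg (dist p.z q.z), sq_nonneg (p.t - q.t)]
    have ht : p.t - q.t = 0 := by nlinarith [sq_nonneg (dist p.z q.z), sq_nonneg (p.t - q.t)]
    exact HypSpace.ext (dist_eq_zero.1 hz) (sub_eq_zero.1 ht)

end HypSpace

/-- The group of isometries of hyperbolic 3-space. -/
abbrev HypIsom := HypSpace ≃ᵢ HypSpace

/-- The tautological action of the isometry group. -/
instance : MulAction HypIsom HypSpace where
  smul g p := g p
  one_smul _ := rfl
  mul_smul _ _ _ := rfl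

/-- The Riemann sphere `ℂ ∪ {∞}`, the ideal boundary of hyperbolic 3-space. -/
abbrev Sphere := OnePoint ℂ

/-- The orbit space `H³ / Γ`, with the quotient topology. -/
abbrev HypQuotient (Γ : Subgroup HypIsom) := MulAction.orbitRel.Quotient Γ HypSpace

/-- A nice lattice (co-compact torsion-free lattice): the quotient `H³ / Γ` is a compact Hausdorff
space and the projection `H³ → H³ / Γ` is a covering map; so `H³ / Γ` is a compact
hyperbolic manifold, with universal covering `H³` and deck group `Γ`. -/
structure IsNiceLattice (Γ : Subgroup HypIsom) : Prop where
  covering : IsCoveringMap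
    (Quotient.mk (MulAction.orbitRel Γ HypSpace) : HypSpace → HypQuotient Γ)
  hausdorff : T2Space (HypQuotient Γ)
  compact : CompactSpace (HypQuotient Γ)

/-- `H³` inside the one-point compactification of `ℂ × ℝ`. -/
def interiorPt (p : HypSpace) : OnePoint (ℂ × ℝ) := ((p.z, p.t) : ℂ × ℝ)

/-- The ideal boundary inside the one-point compactification of `ℂ × ℝ`: `z ↦ (z, 0)`,
`∞ ↦ ∞`. Together with `H³` it forms the closed ball `H³ ∪ S`. -/
def idealPt (ξ : Sphere) : OnePoint (ℂ × ℝ) := OnePoint.map (fun z : ℂ => (z, (0 : ℝ))) ξ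

/-- The homeomorphism `σ` of the sphere extends the isometry `g` of `H³` continuously:
`g p → σ ξ` whenever `p ∈ H³` tends to the ideal point `ξ`. -/
def ExtendsToSphere (g : HypIsom) (σ : Sphere ≃ₜ Sphere) : Prop :=
  ∀ ξ : Sphere, Tendsto (fun p : HypSpace => interiorPt (g p))
    (comap interiorPt (𝓝 (idealPt ξ))) (𝓝 (idealPt (σ ξ)))

/-- The homeomorphisms by which the elements of `Γ` act on the sphere. -/
def sphereAction (Γ : Subgroup HypIsom) : Set (Sphere ≃ₜ Sphere) :=
  {σ | ∃ g ∈ Γ, ExtendsToSphere g σ}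

/-- `h` is equivariant: `h Γ₁ h⁻¹ = Γ₂`, as groups acting on the sphere, for some pair of
nice lattices `Γ₁`, `Γ₂`. -/
def IsEquivariantHomeo (h : Sphere ≃ₜ Sphere) : Prop :=
  ∃ Γ₁ Γ₂ : Subgroup HypIsom, IsNiceLattice Γ₁ ∧ IsNiceLattice Γ₂ ∧
    (fun σ : Sphere ≃ₜ Sphere => h * σ * h⁻¹) '' sphereAction Γ₁ = sphereAction Γ₂

/-- A round disk in the plane, open or closed, of positive radius. -/
def IsDisk (D : Set ℂ) : Prop :=
  ∃ (c : ℂ) (r : ℝ), 0 < r ∧ (D = Metric.ball c r ∨ D = Metric.closedBall c r)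

/-- A subset of the plane seen in the sphere. -/
def inSphere (A : Set ℂ) : Set Sphere := (fun z : ℂ => (z : Sphere)) '' A

end

/-!
Inversion in `ℝ⁴` turns the closed ball `H³ ∪ S` into a subset of a round sphere, and choosing the
inversion according to a point `p` of `H³` makes the resulting chordal distances depend only on
hyperbolic distances to `p`. So an isometry `g` carries the visual distance from `p` to the visual
distance from `g p`, which gives both the extension of `g` to `S` and its effect on `S`.

Since `H³ / Γ₁` is compact, every viewpoint `p` can be moved by `Γ₁` to within bounded distance of a
base point. Equivariance and compactness of `S` then provide, for every `p`, a viewpoint `p'` from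
which the images under `h` of points that are far apart seen from `p` are far apart, uniformly in
`p`. For `‖x - c‖ ≤ ‖y - c‖`, apply this to `p = (c, ‖y - c‖)` and the pairs `(y, c)` and `(x, ∞)`:
the cross ratio of `h x, h y, h c, ∞` is bounded, so `h` is weakly quasisymmetric on the plane.
-/

noncomputable section

open OnePoint Metric

section CompactifiedInversion

open EuclideanGeometry

variable {V P Y : Type*} [NormedAddCommGroup V] [InnerProductSpace ℝ V] [MetricSpace P]
  [NormedAddTorsor V P] {c : P} {R : ℝ} {ι : Y → P}

/-- The inversion with centre `c` and radius `R` applied to a copy `ι` of `Y`, with the point at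
infinity of `Y` sent to the centre. -/
def compactifiedInversion (c : P) (R : ℝ) (ι : Y → P) (a : OnePoint Y) : P :=
  a.elim c (inversion c R ∘ ι)

@[simp] theorem compactifiedInversion_infty : compactifiedInversion c R ι ∞ = c := rfl

@[simp] theorem compactifiedInversion_coe (y : Y) :
    compactifiedInversion c R ι y = inversion c R (ι y) := rfl

theorem tendsto_inversion_cobounded (c : P) (R : ℝ) :
    Tendsto (inversion c R) (Bornology.cobounded P) (𝓝 c) := by
  rw [tendsto_iff_dist_tendsto_zero]
  simp only [dist_inversion_center]
  exact tendsto_const_nhds.div_atTop (tendsto_dist_right_cobounded_atTop c)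

theorem continuous_compactifiedInversion [TopologicalSpace Y] (hι : Continuous ι)
    (hc : ∀ y, ι y ≠ c) (hlim : Tendsto ι (coclosedCompact Y) (Bornology.cobounded P)) :
    Continuous (compactifiedInversion c R ι) :=
  OnePoint.continuous_iff _ |>.2 ⟨(tendsto_inversion_cobounded c R).comp hlim,
    continuous_const.inversion continuous_const hι hc⟩

theorem injective_compactifiedInversion (hR : R ≠ 0) (hι : Function.Injective ι)
    (hc : ∀ y, ι y ≠ c) : Function.Injective (compactifiedInversion c R ι) := by
  intro a b hab
  induction a using OnePoint.rec <;> induction b using OnePoint.rec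
  · rfl
  · exact absurd ((center_eq_inversion hR).1 hab) (hc _)
  · exact absurd ((inversion_eq_center hR).1 hab) (hc _)
  · exact congrArg _ (hι (inversion_injective c hR hab))

end CompactifiedInversion

theorem exists_dist_smul_le_of_compactSpace_quotient (G : Type*) {X : Type*} [Group G]
    [PseudoMetricSpace X] [MulAction G X] [ContinuousConstSMul G X]
    [CompactSpace (MulAction.orbitRel.Quotient G X)] (o : X) :
    ∃ R : ℝ, ∀ x : X, ∃ g : G, dist (g • x) o ≤ R := by
  let π : X → MulAction.orbitRel.Quotient G X := Quotient.mk _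
  obtain ⟨n, hn⟩ := (isCompact_univ (X := MulAction.orbitRel.Quotient G X)).elim_directed_cover
    (fun n : ℕ => π '' ball o n)
    (fun n => isOpenMap_quotient_mk'_mul _ isOpen_ball)
    (fun x _ => by
      obtain ⟨y, rfl⟩ := Quotient.exists_rep x
      obtain ⟨n, hn⟩ := exists_nat_gt (dist y o)
      exact Set.mem_iUnion.2 ⟨n, y, hn, rfl⟩)
    (Monotone.directed_le fun m n hmn =>
      Set.image_mono (ball_subset_ball (Nat.cast_le.2 hmn)))
  refine ⟨n, fun x => ?_⟩
  obtain ⟨y, hy, hyx⟩ := hn (Set.mem_univ (π x))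
  obtain ⟨g, rfl⟩ := MulAction.orbitRel_apply.1 (Quotient.exact hyx)
  exact ⟨g, (mem_ball.1 hy).le⟩

theorem cosh_le_exp_mul_cosh {x y D : ℝ} (h : |x - y| ≤ D) :
    Real.cosh x ≤ Real.exp D * Real.cosh y := by
  obtain ⟨hl, hu⟩ := abs_le.1 h
  rw [Real.cosh_eq, Real.cosh_eq, mul_div_assoc', mul_add, ← Real.exp_add, ← Real.exp_add]
  gcongr <;> linarith

namespace HypSpace

instance : Inhabited HypSpace := ⟨⟨0, 1, one_pos⟩⟩

/-- The centre of the inversion of `ℝ⁴ = ℂ × ℂ` attached to the point `p`. -/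
def pole (p : HypSpace) : WithLp 2 (ℂ × ℂ) := WithLp.toLp 2 (p.z, 0)

/-- The copy of `ℝ³ = ℂ × ℝ` in `ℝ⁴ = ℂ × ℂ` at distance `p.t` from `p.pole`. -/
def slice (p : HypSpace) (a : ℂ × ℝ) : WithLp 2 (ℂ × ℂ) := WithLp.toLp 2 (a.1, ⟨a.2, p.t⟩)

theorem dist_slice_sq (p : HypSpace) (a b : ℂ × ℝ) :
    dist (p.slice a) (p.slice b) ^ 2 = dist a.1 b.1 ^ 2 + (a.2 - b.2) ^ 2 := by
  rw [WithLp.prod_dist_eq_of_L2, Real.sq_sqrt (by positivity)]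
  simp [slice, Complex.dist_of_im_eq, Real.dist_eq]

theorem dist_slice_pole_sq (p : HypSpace) (a : ℂ × ℝ) :
    dist (p.slice a) p.pole ^ 2 = dist a.1 p.z ^ 2 + a.2 ^ 2 + p.t ^ 2 := by
  rw [WithLp.prod_dist_eq_of_L2, Real.sq_sqrt (by positivity)]
  simp [slice, pole, Complex.sq_norm, Complex.normSq_apply]
  ring

theorem t_le_dist_slice_pole (p : HypSpace) (a : ℂ × ℝ) : p.t ≤ dist (p.slice a) p.pole :=
  le_of_sq_le_sq (by rw [dist_slice_pole_sq]; exact le_add_of_nonneg_left (by positivity))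
    dist_nonneg

theorem dist_slice_pole_pos (p : HypSpace) (a : ℂ × ℝ) : 0 < dist (p.slice a) p.pole :=
  p.t_pos.trans_le (p.t_le_dist_slice_pole a)

theorem slice_ne_pole (p : HypSpace) (a : ℂ × ℝ) : p.slice a ≠ p.pole :=
  dist_pos.1 (p.dist_slice_pole_pos a)

theorem antilipschitzWith_slice (p : HypSpace) : AntilipschitzWith 1 p.slice := by
  refine AntilipschitzWith.of_le_mul_dist fun a b => ?_
  rw [NNReal.coe_one, one_mul, Prod.dist_eq, Real.dist_eq]
  refine max_le ?_ ?_ <;> refine (sq_le_sq₀ (by positivity) dist_nonneg).1 ?_ <;>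
    rw [dist_slice_sq]
  · exact le_add_of_nonneg_right (sq_nonneg _)
  · rw [sq_abs]
    exact le_add_of_nonneg_left (sq_nonneg _)

theorem continuous_slice (p : HypSpace) : Continuous p.slice := by
  refine (WithLp.prod_continuous_toLp 2 ℂ ℂ).comp (continuous_fst.prodMk ?_)
  simp only [Complex.mk_eq_add_mul_I]
  fun_prop

/-- The inverse stereographic projection attached to `p`, from the one-point compactification of
`ℂ × ℝ` onto a sphere in `ℝ⁴`. The radius of the inversion makes the diameter of that sphere `1`. -/
def stereo (p : HypSpace) : OnePoint (ℂ × ℝ) → WithLp 2 (ℂ × ℂ) :=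
  compactifiedInversion p.pole √p.t p.slice

theorem isClosedEmbedding_stereo (p : HypSpace) : IsClosedEmbedding p.stereo := by
  refine Continuous.isClosedEmbedding
    (continuous_compactifiedInversion p.continuous_slice p.slice_ne_pole ?_)
    (injective_compactifiedInversion (Real.sqrt_ne_zero'.2 p.t_pos)
      p.antilipschitzWith_slice.injective p.slice_ne_pole)
  rw [coclosedCompact_eq_cocompact, ← cobounded_eq_cocompact]
  exact p.antilipschitzWith_slice.tendsto_cobounded

theorem dist_stereo_coe_coe (p : HypSpace) (a b : ℂ × ℝ) :
    dist (p.stereo a) (p.stereo b) = p.t / (dist (p.slice a) p.pole * dist (p.slice b) p.pole) *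
      dist (p.slice a) (p.slice b) := by
  rw [stereo, compactifiedInversion_coe, compactifiedInversion_coe,
    EuclideanGeometry.dist_inversion_inversion (p.slice_ne_pole a) (p.slice_ne_pole b),
    Real.sq_sqrt p.t_pos.le]

theorem dist_stereo_coe_infty (p : HypSpace) (a : ℂ × ℝ) :
    dist (p.stereo a) (p.stereo ∞) = p.t / dist (p.slice a) p.pole := by
  rw [stereo, compactifiedInversion_coe, compactifiedInversion_infty,
    EuclideanGeometry.dist_inversion_center, Real.sq_sqrt p.t_pos.le]

/-- The height of the image of a point over the image of `S` under the inverse stereographic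
projection attached to `p`. -/
def height (p : HypSpace) (a : OnePoint (ℂ × ℝ)) : ℝ := (p.stereo a).snd.re

theorem continuous_height (p : HypSpace) : Continuous p.height :=
  Complex.continuous_re.comp
    ((continuous_snd.comp (WithLp.prod_continuous_ofLp 2 ℂ ℂ)).comp
      p.isClosedEmbedding_stereo.continuous)

theorem height_infty (p : HypSpace) : p.height ∞ = 0 := rfl

theorem height_coe (p : HypSpace) (a : ℂ × ℝ) :
    p.height a = p.t * a.2 / dist (p.slice a) p.pole ^ 2 := by
  have hstereo : p.stereo a =
      (√p.t / dist (p.slice a) p.pole) ^ 2 • (p.slice a - p.pole) + p.pole := rfl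
  rw [height, hstereo, WithLp.add_snd, WithLp.smul_snd, WithLp.sub_snd, Complex.add_re,
    Complex.smul_re, div_pow, Real.sq_sqrt p.t_pos.le]
  change _ • (a.2 - 0) + 0 = _
  rw [sub_zero, add_zero, smul_eq_mul, div_mul_eq_mul_div]

theorem height_eq_zero_iff (p : HypSpace) {a : OnePoint (ℂ × ℝ)} :
    p.height a = 0 ↔ a ∈ Set.range idealPt := by
  induction a using OnePoint.rec with
  | infty => exact iff_of_true p.height_infty ⟨∞, rfl⟩
  | coe a =>
    rw [height_coe, div_eq_zero_iff, or_iff_left (pow_ne_zero 2 (p.dist_slice_pole_pos a).ne'),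
      mul_eq_zero, or_iff_right p.t_pos.ne']
    refine ⟨fun ha => ?_, ?_⟩
    · have haz : (a.1, (0 : ℝ)) = a := Prod.ext rfl ha.symm
      exact ⟨(a.1 : Sphere), congrArg OnePoint.some haz⟩
    · rintro ⟨ξ, hξ⟩
      induction ξ using OnePoint.rec with
      | infty => exact absurd hξ.symm (OnePoint.coe_ne_infty a)
      | coe z => exact (congrArg Prod.snd (OnePoint.coe_injective hξ)).symm

theorem dist_slice_interiorPt_pole_sq (p q : HypSpace) :
    dist (p.slice (q.z, q.t)) p.pole ^ 2 = 2 * p.t * q.t * Real.cosh (dist q p) := by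
  have hp := p.t_pos
  have hq := q.t_pos
  rw [dist_slice_pole_sq, cosh_dist]
  field_simp
  ring

theorem dist_slice_slice_interiorPt (p q q' : HypSpace) :
    dist (p.slice (q.z, q.t)) (p.slice (q'.z, q'.t)) =
      2 * √(q.t * q'.t) * Real.sinh (dist q q' / 2) := by
  have := q.t_pos
  have := q'.t_pos
  have heucl : dist (p.slice (q.z, q.t)) (p.slice (q'.z, q'.t)) = dist q.toEucl q'.toEucl := by
    rw [← sq_eq_sq₀ dist_nonneg dist_nonneg, dist_slice_sq, eucl_dist_sq]
  rw [heucl, sinh_half_dist, mul_div_cancel₀]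
  positivity

theorem dist_stereo_interiorPt (p q q' : HypSpace) :
    dist (p.stereo (interiorPt q)) (p.stereo (interiorPt q')) =
      Real.sinh (dist q q' / 2) / √(Real.cosh (dist q p) * Real.cosh (dist q' p)) := by
  have hp := p.t_pos
  have hq := q.t_pos
  have hq' := q'.t_pos
  have hpole : dist (p.slice (q.z, q.t)) p.pole * dist (p.slice (q'.z, q'.t)) p.pole =
      2 * p.t * √(q.t * q'.t) * √(Real.cosh (dist q p) * Real.cosh (dist q' p)) := by
    rw [← sq_eq_sq₀ (by positivity) (by positivity), mul_pow, dist_slice_interiorPt_pole_sq,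
      dist_slice_interiorPt_pole_sq, mul_pow, mul_pow, Real.sq_sqrt (by positivity),
      Real.sq_sqrt (by positivity)]
    ring
  rw [interiorPt, interiorPt, dist_stereo_coe_coe, hpole, dist_slice_slice_interiorPt]
  field_simp

theorem height_interiorPt (p q : HypSpace) :
    p.height (interiorPt q) = 1 / (2 * Real.cosh (dist q p)) := by
  have hp := p.t_pos
  have hq := q.t_pos
  rw [interiorPt, height_coe, dist_slice_interiorPt_pole_sq]
  field_simp

theorem dist_stereo_isometry (g : HypIsom) (p q q' : HypSpace) :
    dist ((g p).stereo (interiorPt (g q))) ((g p).stereo (interiorPt (g q'))) =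
      dist (p.stereo (interiorPt q)) (p.stereo (interiorPt q')) := by
  simp only [dist_stereo_interiorPt, g.dist_eq]

theorem height_isometry (g : HypIsom) (p q : HypSpace) :
    (g p).height (interiorPt (g q)) = p.height (interiorPt q) := by
  simp only [height_interiorPt, g.dist_eq]

theorem idealPt_injective : Function.Injective idealPt :=
  Option.map_injective (Prod.mk_left_injective (0 : ℝ))

theorem continuous_idealPt : Continuous idealPt := by
  refine OnePoint.continuous_map (by fun_prop) ?_
  simp only [coclosedCompact_eq_cocompact, ← cobounded_eq_cocompact]
  refine (Isometry.antilipschitz (f := fun z : ℂ => (z, (0 : ℝ)))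
    (Isometry.of_dist_eq fun z w => ?_)).tendsto_cobounded
  simp [Prod.dist_eq]

/-- The filter of points of `H³` tending to the ideal point `ξ`. -/
def toIdeal (ξ : Sphere) : Filter HypSpace := comap interiorPt (𝓝 (idealPt ξ))

theorem tendsto_toIdeal (ξ : Sphere) : Tendsto interiorPt (toIdeal ξ) (𝓝 (idealPt ξ)) :=
  tendsto_comap

theorem idealPt_mem_closure_range_interiorPt (ξ : Sphere) :
    idealPt ξ ∈ closure (Set.range interiorPt) := by
  refine isClosed_property OnePoint.denseRange_coe
    (isClosed_closure.preimage continuous_idealPt) (fun z => ?_) ξ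
  have hlim : Tendsto (fun t : ℝ => ((z, t) : ℂ × ℝ)) (𝓝[>] 0) (𝓝 (z, 0)) :=
    tendsto_const_nhds.prodMk_nhds nhdsWithin_le_nhds
  refine mem_closure_of_tendsto ((OnePoint.continuous_coe.tendsto _).comp hlim) ?_
  filter_upwards [self_mem_nhdsWithin] with t ht
  exact ⟨⟨z, t, ht⟩, rfl⟩

instance (ξ : Sphere) : (toIdeal ξ).NeBot :=
  comap_neBot_iff_frequently.2 (mem_closure_iff_frequently.1
    (idealPt_mem_closure_range_interiorPt ξ))

/-- The visual distance of two ideal points seen from `p`: half the Euclidean distance of their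
images when the ball model of `H³` is centred at `p`. -/
def visualDist (p : HypSpace) (ξ η : Sphere) : ℝ :=
  dist (p.stereo (idealPt ξ)) (p.stereo (idealPt η))

theorem isClosedEmbedding_stereo_idealPt (p : HypSpace) :
    IsClosedEmbedding fun ξ => p.stereo (idealPt ξ) :=
  p.isClosedEmbedding_stereo.comp (continuous_idealPt.isClosedEmbedding idealPt_injective)

theorem continuous_visualDist (p : HypSpace) :
    Continuous fun x : Sphere × Sphere => p.visualDist x.1 x.2 :=
  have := p.isClosedEmbedding_stereo_idealPt.continuous
  (this.comp continuous_fst).dist (this.comp continuous_snd)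

theorem visualDist_pos (p : HypSpace) {ξ η : Sphere} : 0 < p.visualDist ξ η ↔ ξ ≠ η :=
  dist_pos.trans p.isClosedEmbedding_stereo_idealPt.injective.ne_iff

theorem tendsto_dist_stereo_toIdeal (p : HypSpace) (ξ η : Sphere) :
    Tendsto (fun x : HypSpace × HypSpace =>
      dist (p.stereo (interiorPt x.1)) (p.stereo (interiorPt x.2)))
      (toIdeal ξ ×ˢ toIdeal η) (𝓝 (p.visualDist ξ η)) :=
  have h (ζ : Sphere) := (p.isClosedEmbedding_stereo.continuous.tendsto _).comp (tendsto_toIdeal ζ)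
  ((h ξ).comp tendsto_fst).dist ((h η).comp tendsto_snd)

theorem visualDist_map_of_tendsto {g : HypIsom} {ξ η ξ' η' : Sphere}
    (hξ : Tendsto g (toIdeal ξ) (toIdeal ξ')) (hη : Tendsto g (toIdeal η) (toIdeal η'))
    (p : HypSpace) : (g p).visualDist ξ' η' = p.visualDist ξ η := by
  refine tendsto_nhds_unique ?_ (p.tendsto_dist_stereo_toIdeal ξ η)
  exact ((g p).tendsto_dist_stereo_toIdeal ξ' η').comp (hξ.prodMap hη) |>.congr
    fun x => dist_stereo_isometry g p x.1 x.2

theorem visualDist_le (p p' : HypSpace) (ξ η : Sphere) :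
    p.visualDist ξ η ≤ Real.exp (dist p p') * p'.visualDist ξ η := by
  refine le_of_tendsto_of_tendsto' (p.tendsto_dist_stereo_toIdeal ξ η)
    ((p'.tendsto_dist_stereo_toIdeal ξ η).const_mul _) fun ⟨q, q'⟩ => ?_
  have hcosh (q : HypSpace) :
      Real.cosh (dist q p') ≤ Real.exp (dist p p') * Real.cosh (dist q p) :=
    cosh_le_exp_mul_cosh (by
      rw [dist_comm q p', dist_comm q p, dist_comm p p']
      exact abs_dist_sub_le p' p q)
  have hsqrt : √(Real.cosh (dist q p') * Real.cosh (dist q' p')) ≤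
      Real.exp (dist p p') * √(Real.cosh (dist q p) * Real.cosh (dist q' p)) := by
    refine Real.sqrt_le_iff.2 ⟨by positivity, ?_⟩
    rw [mul_pow, Real.sq_sqrt (mul_nonneg (Real.cosh_pos _).le (Real.cosh_pos _).le)]
    calc _ ≤ Real.exp (dist p p') * Real.cosh (dist q p) *
          (Real.exp (dist p p') * Real.cosh (dist q' p)) :=
          mul_le_mul (hcosh q) (hcosh q') (Real.cosh_pos _).le (by positivity)
      _ = _ := by ring
  have hsinh : 0 ≤ Real.sinh (dist q q' / 2) := Real.sinh_nonneg_iff.2 (by positivity)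
  simp only [dist_stereo_interiorPt]
  rw [mul_div_assoc', div_le_div_iff₀ (by positivity) (by positivity)]
  linarith [mul_le_mul_of_nonneg_left hsqrt hsinh]

theorem cauchy_map_stereo (g : HypIsom) (p : HypSpace) (ξ : Sphere) :
    Cauchy (map (fun q => (g p).stereo (interiorPt (g q))) (toIdeal ξ)) := by
  rw [cauchy_map_iff', Metric.uniformity_eq_comap_nhds_zero, tendsto_comap_iff]
  refine Tendsto.congr (fun x => (dist_stereo_isometry g p x.1 x.2).symm) ?_
  have hself : p.visualDist ξ ξ = 0 := dist_self _
  exact hself ▸ p.tendsto_dist_stereo_toIdeal ξ ξ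

theorem exists_tendsto_toIdeal (g : HypIsom) (ξ : Sphere) :
    ∃ η, Tendsto g (toIdeal ξ) (toIdeal η) := by
  let p : HypSpace := default
  have hemb := (g p).isClosedEmbedding_stereo
  obtain ⟨v, hv⟩ := CompleteSpace.complete (cauchy_map_stereo g p ξ)
  obtain ⟨a, rfl⟩ : v ∈ Set.range (g p).stereo :=
    hemb.isClosed_range.mem_of_tendsto hv (Eventually.of_forall fun q => ⟨_, rfl⟩)
  have ha : Tendsto (fun q => interiorPt (g q)) (toIdeal ξ) (𝓝 a) := hemb.tendsto_nhds_iff.2 hv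
  have hheight : (g p).height a = p.height (idealPt ξ) :=
    tendsto_nhds_unique (((g p).continuous_height.tendsto a).comp ha)
      (((p.continuous_height.tendsto _).comp (tendsto_toIdeal ξ)).congr fun q =>
        (height_isometry g p q).symm)
  obtain ⟨η, rfl⟩ :=
    (g p).height_eq_zero_iff.1 (hheight.trans (p.height_eq_zero_iff.2 ⟨ξ, rfl⟩))
  exact ⟨η, tendsto_comap_iff.2 ha⟩

/-- The extension of an isometry of `H³` to the ideal boundary. -/
def boundaryMap (g : HypIsom) (ξ : Sphere) : Sphere := (exists_tendsto_toIdeal g ξ).choose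

theorem tendsto_boundaryMap (g : HypIsom) (ξ : Sphere) :
    Tendsto g (toIdeal ξ) (toIdeal (boundaryMap g ξ)) :=
  (exists_tendsto_toIdeal g ξ).choose_spec

theorem boundaryMap_symm_apply (g : HypIsom) (ξ : Sphere) :
    boundaryMap g.symm (boundaryMap g ξ) = ξ := by
  have hlim := (tendsto_toIdeal _).comp
    ((tendsto_boundaryMap g.symm _).comp (tendsto_boundaryMap g ξ))
  refine idealPt_injective (tendsto_nhds_unique hlim ((tendsto_toIdeal ξ).congr fun q => ?_))
  exact congrArg interiorPt (g.symm_apply_apply q).symm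

theorem continuous_boundaryMap (g : HypIsom) : Continuous (boundaryMap g) := by
  let p : HypSpace := default
  have hembed (q : HypSpace) := q.isClosedEmbedding_stereo_idealPt
  rw [(hembed (g p)).isInducing.continuous_iff, continuous_iff_continuousAt]
  intro ξ
  refine tendsto_iff_dist_tendsto_zero.2 (Tendsto.congr (fun η => ?_)
    (tendsto_iff_dist_tendsto_zero.1 ((hembed p).continuous.tendsto ξ)))
  exact (visualDist_map_of_tendsto (tendsto_boundaryMap g η) (tendsto_boundaryMap g ξ) p).symm

theorem exists_extendsToSphere (g : HypIsom) : ∃ σ, ExtendsToSphere g σ :=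
  ⟨{ toFun := boundaryMap g
     invFun := boundaryMap g.symm
     left_inv := boundaryMap_symm_apply g
     right_inv := boundaryMap_symm_apply g.symm
     continuous_toFun := continuous_boundaryMap g
     continuous_invFun := continuous_boundaryMap g.symm },
    fun ξ => (tendsto_toIdeal _).comp (tendsto_boundaryMap g ξ)⟩

theorem visualDist_map {g : HypIsom} {σ : Sphere ≃ₜ Sphere} (hσ : ExtendsToSphere g σ)
    (p : HypSpace) (ξ η : Sphere) : (g p).visualDist (σ ξ) (σ η) = p.visualDist ξ η :=
  visualDist_map_of_tendsto (tendsto_comap_iff.2 (hσ ξ)) (tendsto_comap_iff.2 (hσ η)) p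

theorem visualDist_coe_infty (p : HypSpace) (z : ℂ) :
    p.visualDist z ∞ = p.t / dist (p.slice (z, 0)) p.pole :=
  p.dist_stereo_coe_infty (z, 0)

theorem visualDist_coe_coe (p : HypSpace) (z w : ℂ) :
    p.visualDist z w = dist z w * (p.visualDist z ∞ * p.visualDist w ∞) / p.t := by
  have hp := p.t_pos
  have hslice : dist (p.slice (z, 0)) (p.slice (w, 0)) = dist z w := by
    rw [← sq_eq_sq₀ dist_nonneg dist_nonneg, dist_slice_sq, sub_self, zero_pow two_ne_zero,
      add_zero]
  refine (p.dist_stereo_coe_coe (z, 0) (w, 0)).trans ?_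
  rw [visualDist_coe_infty, visualDist_coe_infty, hslice]
  field_simp

theorem visualDist_infty_le_one (p : HypSpace) (z : ℂ) : p.visualDist z ∞ ≤ 1 := by
  rw [visualDist_coe_infty]
  exact div_le_one_of_le₀ (p.t_le_dist_slice_pole _) dist_nonneg

theorem visualDist_coe_le_two (p : HypSpace) (z w : ℂ) : p.visualDist z w ≤ 2 :=
  calc p.visualDist z w ≤ p.visualDist z ∞ + p.visualDist w ∞ := dist_triangle_right _ _ _
    _ ≤ 1 + 1 := add_le_add (p.visualDist_infty_le_one z) (p.visualDist_infty_le_one w)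
    _ = 2 := one_add_one_eq_two

theorem half_le_visualDist_infty {p : HypSpace} {z : ℂ} (hz : dist z p.z ≤ p.t) :
    1 / 2 ≤ p.visualDist z ∞ := by
  have hp := p.t_pos
  rw [visualDist_coe_infty, div_le_div_iff₀ two_pos (p.dist_slice_pole_pos _), one_mul]
  refine (sq_le_sq₀ dist_nonneg (by positivity)).1 ?_
  rw [dist_slice_pole_sq]
  nlinarith [dist_nonneg (x := z) (y := p.z)]

theorem dist_mul_visualDist_eq (p : HypSpace) (x y c : ℂ) :
    dist x c * (p.visualDist y c * p.visualDist x ∞) =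
      dist y c * (p.visualDist x c * p.visualDist y ∞) := by
  rw [p.visualDist_coe_coe x c, p.visualDist_coe_coe y c]
  ring

theorem exists_le_visualDist_map (p : HypSpace) {h : Sphere → Sphere} (hcont : Continuous h)
    (hinj : Function.Injective h) {ε : ℝ} (hε : 0 < ε) :
    ∃ δ > 0, ∀ ξ η, ε ≤ p.visualDist ξ η → δ ≤ p.visualDist (h ξ) (h η) := by
  have hcompact : IsCompact {x : Sphere × Sphere | ε ≤ p.visualDist x.1 x.2} :=
    (isClosed_le continuous_const p.continuous_visualDist).isCompact
  obtain ⟨δ, hδ, hmin⟩ := hcompact.exists_forall_le' (a := 0)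
    (p.continuous_visualDist.comp (hcont.prodMap hcont)).continuousOn fun x hx =>
      p.visualDist_pos.2 (hinj.ne (p.visualDist_pos.1 (hε.trans_le hx)))
  exact ⟨δ, hδ, fun ξ η => hmin (ξ, η)⟩

instance (Γ : Subgroup HypIsom) : ContinuousConstSMul Γ HypSpace :=
  ⟨fun g => g.1.continuous⟩

theorem exists_forall_le_visualDist_map (Γ : Subgroup HypIsom) [CompactSpace (HypQuotient Γ)]
    {h : Sphere ≃ₜ Sphere}
    (hΓ : ∀ σ ∈ sphereAction Γ, ∃ g, ExtendsToSphere g (h * σ * h⁻¹)) {ε : ℝ} (hε : 0 < ε) :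
    ∃ δ > 0, ∀ p : HypSpace, ∃ p' : HypSpace,
      ∀ ξ η, ε ≤ p.visualDist ξ η → δ ≤ p'.visualDist (h ξ) (h η) := by
  let o : HypSpace := default
  obtain ⟨R, hR⟩ := exists_dist_smul_le_of_compactSpace_quotient Γ o
  obtain ⟨δ, hδ, hsep⟩ := o.exists_le_visualDist_map h.continuous h.injective
    (ε := Real.exp (-R) * ε) (by positivity)
  refine ⟨δ, hδ, fun p => ?_⟩
  obtain ⟨⟨γ, hγ⟩, hdist⟩ := hR p
  obtain ⟨σ, hσ⟩ := exists_extendsToSphere γ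
  obtain ⟨g, hg⟩ := hΓ σ ⟨γ, hγ, hσ⟩
  refine ⟨g.symm o, fun ξ η hξη => ?_⟩
  have hbase : Real.exp (-R) * ε ≤ o.visualDist (σ ξ) (σ η) := by
    rw [Real.exp_neg, inv_mul_le_iff₀ (Real.exp_pos R)]
    calc ε ≤ (γ p).visualDist (σ ξ) (σ η) := hξη.trans_eq (visualDist_map hσ p ξ η).symm
      _ ≤ Real.exp (dist (γ p) o) * o.visualDist (σ ξ) (σ η) := visualDist_le _ _ _ _
      _ ≤ Real.exp R * o.visualDist (σ ξ) (σ η) :=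
        mul_le_mul_of_nonneg_right (Real.exp_le_exp.2 hdist) dist_nonneg
  have hconj (ζ : Sphere) : (h * σ * h⁻¹) (h ζ) = h (σ ζ) :=
    congrArg (fun ω => h (σ ω)) (h.symm_apply_apply ζ)
  calc δ ≤ o.visualDist (h (σ ξ)) (h (σ η)) := hsep _ _ hbase
    _ = (g (g.symm o)).visualDist ((h * σ * h⁻¹) (h ξ)) ((h * σ * h⁻¹) (h η)) := by
      rw [hconj, hconj, g.apply_symm_apply]
    _ = (g.symm o).visualDist (h ξ) (h η) := visualDist_map hg _ _ _

end HypSpace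

section WeaklyQuasisymmetric

variable {X Y : Type*} [PseudoMetricSpace X] [PseudoMetricSpace Y] {K : ℝ} {f : X → Y}

/-- `f` is weakly quasisymmetric with constant `K`: if `x` is no farther from `c` than `y` is, then
`f x` is at most `K` times farther from `f c` than `f y` is. -/
def IsWeaklyQuasisymmetric (K : ℝ) (f : X → Y) : Prop :=
  ∀ ⦃x y c : X⦄, dist x c ≤ dist y c → dist (f x) (f c) ≤ K * dist (f y) (f c)

theorem IsWeaklyQuasisymmetric.image_closedBall_subset (hf : IsWeaklyQuasisymmetric K f)
    (y c : X) : f '' closedBall c (dist y c) ⊆ closedBall (f c) (K * dist (f y) (f c)) :=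
  Set.image_subset_iff.2 fun _ hx => hf hx

theorem IsWeaklyQuasisymmetric.ball_subset_image_ball (hf : IsWeaklyQuasisymmetric K f)
    (hK : 0 < K) (hsurj : Function.Surjective f) (y c : X) :
    ball (f c) (dist (f y) (f c) / K) ⊆ f '' ball c (dist y c) := by
  intro w hw
  obtain ⟨x, rfl⟩ := hsurj w
  rw [mem_ball, lt_div_iff₀' hK] at hw
  exact ⟨x, not_le.1 fun hyx => hw.not_ge (hf hyx), rfl⟩

end WeaklyQuasisymmetric

theorem IsDisk.exists_ball_subset {Δ : Set ℂ} (hΔ : IsDisk Δ) :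
    ∃ c r, 0 < r ∧ ball c r ⊆ Δ ∧ Δ ⊆ closedBall c r := by
  obtain ⟨c, r, hr, rfl | rfl⟩ := hΔ
  · exact ⟨c, r, hr, subset_rfl, ball_subset_closedBall⟩
  · exact ⟨c, r, hr, ball_subset_closedBall, subset_rfl⟩

theorem IsWeaklyQuasisymmetric.exists_isDisk {K : ℝ} {f : ℂ ≃ ℂ} (hf : IsWeaklyQuasisymmetric K f)
    {Δ : Set ℂ} (hΔ : IsDisk Δ) :
    ∃ D₁ D₂, IsDisk D₁ ∧ IsDisk D₂ ∧ D₁ ⊆ f '' Δ ∧ f '' Δ ⊆ D₂ ∧ diam D₂ / diam D₁ = K ^ 2 := by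
  obtain ⟨c, r, hr, hball, hclosedBall⟩ := hΔ.exists_ball_subset
  obtain ⟨y, rfl⟩ : ∃ y, dist y c = r := ⟨c + r, by simp [hr.le]⟩
  have hρ : 0 < dist (f y) (f c) := dist_pos.2 (f.injective.ne (dist_pos.1 hr))
  have hK : 0 < K := pos_of_mul_pos_left (hρ.trans_le (hf le_rfl)) hρ.le
  refine ⟨ball (f c) (dist (f y) (f c) / K), closedBall (f c) (K * dist (f y) (f c)),
    ⟨_, _, by positivity, .inl rfl⟩, ⟨_, _, by positivity, .inr rfl⟩,
    (hf.ball_subset_image_ball hK f.surjective y c).trans (Set.image_mono hball),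
    (Set.image_mono hclosedBall).trans (hf.image_closedBall_subset y c), ?_⟩
  rw [diam_closedBall_eq _ (by positivity), diam_ball_eq _ (by positivity)]
  field_simp

theorem exists_isWeaklyQuasisymmetric (Γ : Subgroup HypIsom) [CompactSpace (HypQuotient Γ)]
    {h : Sphere ≃ₜ Sphere}
    (hΓ : ∀ σ ∈ sphereAction Γ, ∃ g, ExtendsToSphere g (h * σ * h⁻¹)) (hinf : h ∞ = ∞)
    {f : ℂ → ℂ} (hf : ∀ z : ℂ, h z = f z) : ∃ K, IsWeaklyQuasisymmetric K f := by
  obtain ⟨δ, hδ, hsep⟩ := HypSpace.exists_forall_le_visualDist_map Γ hΓ (ε := 1 / 4) (by norm_num)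
  refine ⟨2 / δ ^ 2, fun x y c hxy => ?_⟩
  rcases (dist_nonneg (x := y) (y := c)).eq_or_lt with hyc | hyc
  · rw [dist_le_zero.1 (hxy.trans_eq hyc.symm), dist_self]
    positivity
  let p : HypSpace := ⟨c, dist y c, hyc⟩
  obtain ⟨p', hp'⟩ := hsep p
  have half_le {z : ℂ} (hz : dist z c ≤ dist y c) : 1 / 2 ≤ p.visualDist z ∞ :=
    HypSpace.half_le_visualDist_infty hz
  have hyc' : δ ≤ p'.visualDist (f y) (f c) := by
    suffices 1 / 4 ≤ p.visualDist y c by simpa only [hf] using hp' _ _ this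
    rw [HypSpace.visualDist_coe_coe, mul_div_right_comm, div_self hyc.ne']
    nlinarith [half_le (le_refl (dist y c)), half_le ((dist_self c).trans_le hyc.le)]
  have hx' : δ ≤ p'.visualDist (f x) ∞ := by
    have hx : 1 / 4 ≤ p.visualDist x ∞ := by linarith [half_le hxy]
    simpa only [hf, hinf] using hp' _ _ hx
  rw [div_mul_eq_mul_div, le_div_iff₀ (by positivity)]
  calc dist (f x) (f c) * δ ^ 2
      ≤ dist (f x) (f c) * (p'.visualDist (f y) (f c) * p'.visualDist (f x) ∞) := by
        rw [sq]
        exact mul_le_mul_of_nonneg_left (mul_le_mul hyc' hx' hδ.le (hδ.le.trans hyc')) dist_nonneg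
    _ = dist (f y) (f c) * (p'.visualDist (f x) (f c) * p'.visualDist (f y) ∞) :=
        p'.dist_mul_visualDist_eq _ _ _
    _ ≤ dist (f y) (f c) * (2 * 1) :=
        mul_le_mul_of_nonneg_left (mul_le_mul (p'.visualDist_coe_le_two _ _)
          (p'.visualDist_infty_le_one _) dist_nonneg two_pos.le) dist_nonneg
    _ = 2 * dist (f y) (f c) := by ring

theorem exists_equiv_of_map_infty {X Y : Type*} {h : OnePoint X ≃ OnePoint Y} (hinf : h ∞ = ∞) :
    ∃ f : X ≃ Y, ∀ x : X, h x = f x := by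
  refine ⟨Equiv.removeNone h, fun x => ?_⟩
  obtain ⟨y, hy⟩ := OnePoint.ne_infty_iff_exists.1
    (hinf ▸ h.injective.ne (OnePoint.coe_ne_infty x))
  exact (Equiv.removeNone_some h ⟨y, hy.symm⟩).symm

theorem image_inSphere {h : Sphere → Sphere} {f : ℂ → ℂ} (hf : ∀ z : ℂ, h z = f z) (A : Set ℂ) :
    h '' inSphere A = inSphere (f '' A) := by
  simp only [inSphere, Set.image_image, hf]

theorem mainTheorem9_general (Γ : Subgroup HypIsom) [CompactSpace (HypQuotient Γ)]
    (h : Sphere ≃ₜ Sphere) (hΓ : ∀ σ ∈ sphereAction Γ, ∃ g, ExtendsToSphere g (h * σ * h⁻¹))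
    (hinf : h ∞ = ∞) :
    ∃ K : ℝ, ∀ Δ : Set ℂ, IsDisk Δ →
      ∃ D₁ D₂ : Set ℂ, IsDisk D₁ ∧ IsDisk D₂ ∧
        inSphere D₁ ⊆ h '' inSphere Δ ∧ h '' inSphere Δ ⊆ inSphere D₂ ∧
        diam D₂ / diam D₁ < K := by
  obtain ⟨f, hf : ∀ z : ℂ, h z = f z⟩ := exists_equiv_of_map_infty (h := h.toEquiv) hinf
  obtain ⟨K, hqs⟩ := exists_isWeaklyQuasisymmetric Γ hΓ hinf hf
  refine ⟨K ^ 2 + 1, fun Δ hΔ => ?_⟩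
  obtain ⟨D₁, D₂, hD₁, hD₂, hsub₁, hsub₂, hdiam⟩ := hqs.exists_isDisk hΔ
  rw [image_inSphere hf]
  exact ⟨D₁, D₂, hD₁, hD₂, Set.image_mono hsub₁, Set.image_mono hsub₂,
    hdiam.trans_lt (lt_add_one _)⟩

end

theorem mainTheorem9 (h : Sphere ≃ₜ Sphere) (hequiv : IsEquivariantHomeo h)
    (hinf : h OnePoint.infty = OnePoint.infty) :
    ∃ K : ℝ, ∀ Δ : Set ℂ, IsDisk Δ →
      ∃ D₁ D₂ : Set ℂ, IsDisk D₁ ∧ IsDisk D₂ ∧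
        inSphere D₁ ⊆ h '' inSphere Δ ∧ h '' inSphere Δ ⊆ inSphere D₂ ∧
        Metric.diam D₂ / Metric.diam D₁ < K := by
  obtain ⟨Γ₁, Γ₂, hΓ₁, -, hconj⟩ := hequiv
  have := hΓ₁.compact
  exact mainTheorem9_general Γ₁ h
    (fun σ hσ => (hconj.le ⟨σ, hσ, rfl⟩).imp fun _ hg => hg.2) hinf
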